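/- Let $T$ be Thompson's group $T$: the group, under composition, of all orientation preserving homeomorphisms of the circle $\mathbf{S}^1=\mathbf{R}/\mathbf{Z}$ that are piecewise linear with only finitely many breakpoints, all at (images of) dyadic rationals, with slopes all of the form $2^k$, $k\in\mathbf{Z}$, and that map (images of) dyadic rationals to (images of) dyadic rationals. Let $T$ act on $\mathbf{S}^1$ in the natural way and write $T_z$ for the stabilizer of $z\in\mathbf{S}^1$ in $T$. For a subgroup $H$ of a discrete group $G$ and a unitary representation $(\sigma,\mathcal K)$ of $H$, let $\operatorname{Ind}_H^G\sigma$ be the unitary representation of $G$ by left translation, $(\pi(g)F)(x)=F(g^{-1}x)$, on the Hilbert space of maps $F:G\to\mathcal K$ with $F(xh)=\sigma(h^{-1})F(x)$ for all $x\in G$, $h\in H$ and $\sum_{x\in G/H}\|F(x)\|^2<\infty$; and for $g\in G$ let $\sigma^{g}$ be the representation $k\mapsto\sigma(gkg^{-1})$ of $g^{-1}Hg$. Let $\lambda_{G/H}=\operatorname{Ind}_H^G 1_H$ be the quasi-regular representation. Equivalence of representations means unitary equivalence. Subgroups $H,L$ of $G$ are \emph{representation equivalent} if $\lambda_{G/H}$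 and $\lambda_{G/L}$ are unitarily equivalent; they are \emph{weakly conjugate} if their conjugacy classes have the same closure in the space of subgroups of $G$ with the Chabauty topology (the topology induced from the product topology on $\{0,1\}^G$). Let $x,y\in\mathbf{S}^1$. Then: (i) For every finite dimensional irreducible unitary representation $\sigma$ of $T_x$, the representation $\operatorname{Ind}_{T_x}^T\sigma$ is irreducible. (ii) For all finite dimensional irreducible unitary representations $\sigma$ of $T_x$ and $\rho$ of $T_y$, the representations $\operatorname{Ind}_{T_x}^T\sigma$ and $\operatorname{Ind}_{T_y}^T\rho$ are equivalent if and only if there exists $g\in T$ such that $gx=y$ and $\rho$ is equivalent to $\sigma^{g^{-1}}$. (iii) If $y\notin Tx$, then $T_x$ and $T_y$ are not representation equivalent. (iv) If neither $x$ nor $y$ belongs to $\mathbf{Q}/\mathbf{Z}$ (the set of points $e^{2\pi i\theta}$ with $\theta\in\mathbf{Q}$), then $T_x$ and $T_y$ are weakly conjugate. -/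

import Mathlib

open Filter Topology

namespace ThompsonRep

noncomputable section

/-! ### Unitary representations -/

section Representations

variable {G : Type*} [Group G]

/-- A unitary representation is a homomorphism `π : G →* (V ≃ₗᵢ[ℂ] V)` into the unitary group
of a Hilbert space `V`. It is irreducible if `V ≠ 0` and the only closed invariant subspaces are
`0` and `V`. -/
def IsIrreducibleRep {V : Type*} [NormedAddCommGroup V] [InnerProductSpace ℂ V]
    (π : G →* (V ≃ₗᵢ[ℂ] V)) : Prop :=
  Nontrivial V ∧ ∀ W : Submodule ℂ V, IsClosed (W : Set V) →
    (∀ g : G, ∀ v ∈ W, π g v ∈ W) → W = ⊥ ∨ W = ⊤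

/-- Unitary equivalence of two unitary representations of the same group. -/
def UnitarilyEquivalent {V W : Type*} [NormedAddCommGroup V] [InnerProductSpace ℂ V]
    [NormedAddCommGroup W] [InnerProductSpace ℂ W]
    (π : G →* (V ≃ₗᵢ[ℂ] V)) (ρ : G →* (W ≃ₗᵢ[ℂ] W)) : Prop :=
  ∃ U : V ≃ₗᵢ[ℂ] W, ∀ (g : G) (v : V), U (π g v) = ρ g (U v)

/-- For a representation `σ` of `H`, the representation `σ^g` of `L = g⁻¹ H g`, given by
`σ^g(k) = σ(g k g⁻¹)`. -/
def conjRep {K : Type*} [NormedAddCommGroup K] [InnerProductSpace ℂ K] (g : G)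
    {H L : Subgroup G} (hL : L = H.map (MulAut.conj g⁻¹).toMonoidHom)
    (σ : H →* (K ≃ₗᵢ[ℂ] K)) : L →* (K ≃ₗᵢ[ℂ] K) :=
  σ.comp (((MulAut.conj g).toMonoidHom.comp L.subtype).codRestrict H (by
    subst hL
    rintro ⟨k, h, hh, rfl⟩
    have e : g * (g⁻¹ * h * g⁻¹⁻¹) * g⁻¹ = h := by group
    change g * (g⁻¹ * h * g⁻¹⁻¹) * g⁻¹ ∈ H
    rwa [e]))

theorem conjRep_apply {K : Type*} [NormedAddCommGroup K] [InnerProductSpace ℂ K] (g : G)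
    {H L : Subgroup G} (hL : L = H.map (MulAut.conj g⁻¹).toMonoidHom)
    (σ : H →* (K ≃ₗᵢ[ℂ] K)) (k : L) (hk : g * k * g⁻¹ ∈ H) :
    conjRep g hL σ k = σ ⟨g * k * g⁻¹, hk⟩ := rfl

theorem stabilizer_eq_conj {X : Type*} [MulAction G X] {x y : X} {g : G} (h : g • x = y) :
    MulAction.stabilizer G y =
      (MulAction.stabilizer G x).map (MulAut.conj (g⁻¹)⁻¹).toMonoidHom := by
  subst h
  rw [inv_inv]
  exact MulAction.stabilizer_smul_eq_stabilizer_map_conj g x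

/-! ### Induced representations -/

variable {H : Subgroup G} {K : Type*} [NormedAddCommGroup K] [InnerProductSpace ℂ K]

theorem memlp_two_iff {ι E : Type*} [NormedAddCommGroup E] {f : ι → E} :
    Memℓp f 2 ↔ Summable fun i => ‖f i‖ ^ 2 := by
  rw [memℓp_gen_iff (by norm_num)]
  simp

/-- The maps `F : G → K` with `F (x h) = σ(h⁻¹) F(x)` for `h ∈ H`, and
`∑_{x ∈ G/H} ‖F x‖² < ∞`; since `‖F x‖` depends only on the coset of `x`, the sum is taken over
a set of representatives (see `norm_out`). -/
def indSubmodule (σ : H →* (K ≃ₗᵢ[ℂ] K)) : Submodule ℂ (G → K) where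
  carrier := {F | (∀ (x : G) (h : H), F (x * h) = σ h⁻¹ (F x)) ∧
    Summable fun q : G ⧸ H => ‖F q.out‖ ^ 2}
  add_mem' := by
    rintro F₁ F₂ ⟨h₁, s₁⟩ ⟨h₂, s₂⟩
    exact ⟨fun x h => by simp [h₁ x h, h₂ x h],
      memlp_two_iff.1 ((memlp_two_iff.2 s₁).add (memlp_two_iff.2 s₂))⟩
  zero_mem' := ⟨fun x h => by simp, by simp⟩
  smul_mem' := by
    rintro c F ⟨h₁, s₁⟩
    exact ⟨fun x h => by simp [h₁ x h], memlp_two_iff.1 ((memlp_two_iff.2 s₁).const_smul c)⟩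

/-- The Hilbert space of the induced representation. -/
def IndSpace (σ : H →* (K ≃ₗᵢ[ℂ] K)) : Type _ := indSubmodule σ

namespace IndSpace

variable (σ : H →* (K ≃ₗᵢ[ℂ] K))

instance : AddCommGroup (IndSpace σ) := inferInstanceAs (AddCommGroup (indSubmodule σ))

instance : Module ℂ (IndSpace σ) := inferInstanceAs (Module ℂ (indSubmodule σ))

variable {σ}

/-- The underlying map `G → K`. -/
def toFun (F : IndSpace σ) : G → K := Subtype.val F

theorem toFun_injective : Function.Injective (toFun : IndSpace σ → G → K) :=
  Subtype.val_injective

theorem map_mul (F : IndSpace σ) (x : G) (h : H) : F.toFun (x * h) = σ h⁻¹ (F.toFun x) :=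
  F.2.1 x h

theorem apply_eq (F : IndSpace σ) (x : G) :
    F.toFun x = σ ⟨x⁻¹ * (x : G ⧸ H).out, QuotientGroup.eq.1 (by simp)⟩
      (F.toFun (x : G ⧸ H).out) := by
  have hm : (x : G ⧸ H).out⁻¹ * x ∈ H := QuotientGroup.eq.1 (by simp)
  have := F.map_mul (x : G ⧸ H).out ⟨_, hm⟩
  simp only [mul_inv_cancel_left] at this
  rw [this]
  congr 2
  ext
  simp

theorem norm_out (F : IndSpace σ) (x : G) : ‖F.toFun (x : G ⧸ H).out‖ = ‖F.toFun x‖ := by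
  rw [F.apply_eq x, LinearIsometryEquiv.norm_map]

variable (σ)

/-- Restriction of `F` to a set of representatives of `G/H`. -/
def restr : IndSpace σ →ₗ[ℂ] lp (fun _ : G ⧸ H => K) 2 where
  toFun F := ⟨fun q => F.toFun q.out, memlp_two_iff.2 F.2.2⟩
  map_add' _ _ := rfl
  map_smul' _ _ := rfl

theorem restr_apply (F : IndSpace σ) (q : G ⧸ H) : restr σ F q = F.toFun q.out := rfl

theorem restr_injective : Function.Injective (restr σ) := by
  intro F₁ F₂ h
  apply toFun_injective
  funext x
  rw [F₁.apply_eq, F₂.apply_eq, ← restr_apply σ F₁, ← restr_apply σ F₂, h]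

theorem restr_surjective : Function.Surjective (restr σ) := by
  intro v
  have hm : ∀ x : G, x⁻¹ * (x : G ⧸ H).out ∈ H := fun x => QuotientGroup.eq.1 (by simp)
  have hout : ∀ q : G ⧸ H, σ ⟨q.out⁻¹ * ((q.out : G) : G ⧸ H).out, hm _⟩
      (v ((q.out : G) : G ⧸ H)) = v q := by
    intro q
    have : (⟨q.out⁻¹ * ((q.out : G) : G ⧸ H).out, hm _⟩ : H) = 1 := by
      ext; simp
    rw [this, map_one, QuotientGroup.out_eq']
    rfl
  refine ⟨⟨fun x => σ ⟨x⁻¹ * (x : G ⧸ H).out, hm x⟩ (v (x : G ⧸ H)), ?_, ?_⟩, ?_⟩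
  · intro x h
    have hq : ((x * h : G) : G ⧸ H) = x := by simp
    change σ ⟨(x * h)⁻¹ * ((x * h : G) : G ⧸ H).out, hm (x * h)⟩ (v ((x * h : G) : G ⧸ H)) =
      (σ h⁻¹ * σ ⟨x⁻¹ * (x : G ⧸ H).out, hm x⟩) (v (x : G ⧸ H))
    rw [← _root_.map_mul]
    have e : (⟨(x * h)⁻¹ * ((x * h : G) : G ⧸ H).out, hm (x * h)⟩ : H) =
        h⁻¹ * ⟨x⁻¹ * (x : G ⧸ H).out, hm x⟩ := by
      ext
      simp [hq, mul_assoc]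
    rw [e, hq]
  · simp only [hout]
    exact memlp_two_iff.1 v.2
  · ext q
    exact hout q

/-- The norm, with `‖F‖² = ∑_{x ∈ G/H} ‖F x‖²`. -/
instance : NormedAddCommGroup (IndSpace σ) :=
  NormedAddCommGroup.induced (IndSpace σ) (lp (fun _ : G ⧸ H => K) 2) (restr σ)
    (restr_injective σ)

/-- The inner product `⟨F₁, F₂⟩ = ∑_{x ∈ G/H} ⟨F₁ x, F₂ x⟩`. -/
instance : InnerProductSpace ℂ (IndSpace σ) where
  norm_smul_le c F := by
    change ‖restr σ (c • F)‖ ≤ ‖c‖ * ‖restr σ F‖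
    rw [map_smul, norm_smul]
  inner F₁ F₂ := inner ℂ (restr σ F₁) (restr σ F₂)
  norm_sq_eq_re_inner F := norm_sq_eq_re_inner (restr σ F)
  conj_inner_symm F₁ F₂ := inner_conj_symm (restr σ F₁) (restr σ F₂)
  add_left F₁ F₂ F₃ := by rw [map_add, inner_add_left]
  smul_left F₁ F₂ c := by rw [map_smul, inner_smul_left]

theorem inner_eq_tsum (F₁ F₂ : IndSpace σ) :
    inner ℂ F₁ F₂ = ∑' q : G ⧸ H, inner ℂ (F₁.toFun q.out) (F₂.toFun q.out) := rfl

theorem norm_sq_eq_tsum (F : IndSpace σ) :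
    ‖F‖ ^ 2 = ∑' q : G ⧸ H, ‖F.toFun q.out‖ ^ 2 := by
  have := lp.norm_rpow_eq_tsum (p := 2) (by norm_num) (restr σ F)
  simp only [ENNReal.toReal_ofNat, Real.rpow_ofNat] at this
  exact this

instance [CompleteSpace K] : CompleteSpace (IndSpace σ) := by
  have hi : Isometry (restr σ) := AddMonoidHomClass.isometry_of_norm _ fun _ => rfl
  exact (completeSpace_congr (e := Equiv.ofBijective _ ⟨restr_injective σ, restr_surjective σ⟩)
    hi.isUniformEmbedding).2 inferInstance

theorem coe_mul_out (g : G) (q : G ⧸ H) : ((g * q.out : G) : G ⧸ H) = g • q := by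
  conv_rhs => rw [← QuotientGroup.out_eq' q]
  rfl

theorem summable_translate (F : IndSpace σ) (g : G) :
    Summable fun q : G ⧸ H => ‖F.toFun (g * q.out)‖ ^ 2 := by
  have h := (MulAction.toPerm g : Equiv.Perm (G ⧸ H)).summable_iff.2 F.2.2
  refine h.congr fun q => ?_
  rw [← F.norm_out (g * q.out), coe_mul_out]
  rfl

/-- Left translation `(π(g) F)(x) = F(g⁻¹ x)`. -/
def translate (g : G) : IndSpace σ →ₗ[ℂ] IndSpace σ where
  toFun F := ⟨fun x => F.toFun (g⁻¹ * x),
    fun x h => by simpa only [mul_assoc] using F.map_mul (g⁻¹ * x) h, F.summable_translate σ g⁻¹⟩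
  map_add' _ _ := rfl
  map_smul' _ _ := rfl

theorem translate_apply (g : G) (F : IndSpace σ) (x : G) :
    (translate σ g F).toFun x = F.toFun (g⁻¹ * x) := rfl

theorem translate_mul (g h : G) (F : IndSpace σ) :
    translate σ (g * h) F = translate σ g (translate σ h F) := by
  apply toFun_injective
  funext x
  simp [translate_apply, mul_assoc]

theorem translate_one (F : IndSpace σ) : translate σ 1 F = F := by
  apply toFun_injective
  funext x
  simp [translate_apply]

theorem norm_translate (g : G) (F : IndSpace σ) : ‖translate σ g F‖ = ‖F‖ := by
  rw [← sq_eq_sq₀ (norm_nonneg _) (norm_nonneg _), norm_sq_eq_tsum, norm_sq_eq_tsum,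
    ← (MulAction.toPerm g⁻¹ : Equiv.Perm (G ⧸ H)).tsum_eq fun q => ‖F.toFun q.out‖ ^ 2]
  refine tsum_congr fun q => ?_
  rw [translate_apply, ← F.norm_out (g⁻¹ * q.out)]
  rw [coe_mul_out]
  rfl

end IndSpace

/-- The induced representation `Ind_H^G σ`, acting by left translation on `IndSpace σ`. -/
def ind (σ : H →* (K ≃ₗᵢ[ℂ] K)) : G →* (IndSpace σ ≃ₗᵢ[ℂ] IndSpace σ) where
  toFun g :=
    { IndSpace.translate σ g with
      invFun := IndSpace.translate σ g⁻¹
      left_inv := fun F => by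
        change IndSpace.translate σ g⁻¹ (IndSpace.translate σ g F) = F
        rw [← IndSpace.translate_mul, inv_mul_cancel, IndSpace.translate_one]
      right_inv := fun F => by
        change IndSpace.translate σ g (IndSpace.translate σ g⁻¹ F) = F
        rw [← IndSpace.translate_mul, mul_inv_cancel, IndSpace.translate_one]
      norm_map' := IndSpace.norm_translate σ g }
  map_one' := by
    ext F : 1
    exact IndSpace.translate_one σ F
  map_mul' g h := by
    ext F : 1
    exact IndSpace.translate_mul σ g h F

theorem ind_apply (σ : H →* (K ≃ₗᵢ[ℂ] K)) (g : G) (F : IndSpace σ) (x : G) :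
    (ind σ g F).toFun x = F.toFun (g⁻¹ * x) := rfl

variable (H)

/-- The quasi-regular representation `λ_{G/H} = Ind_H^G 1_H`. -/
def quasiRegular : G →* (IndSpace (1 : H →* (ℂ ≃ₗᵢ[ℂ] ℂ)) ≃ₗᵢ[ℂ] IndSpace (1 : H →* (ℂ ≃ₗᵢ[ℂ] ℂ))) :=
  ind (1 : H →* (ℂ ≃ₗᵢ[ℂ] ℂ))

/-! ### Relations between subgroups -/

/-- Subgroups are representation equivalent if their quasi-regular representations are unitarily
equivalent. -/
def RepEquivalent (H L : Subgroup G) : Prop :=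
  UnitarilyEquivalent (quasiRegular H) (quasiRegular L)

open scoped Classical in
/-- The Chabauty topology on the set of subgroups of a discrete group: the topology induced from
the product topology on `{0,1}^G` by `H ↦ 1_H`. -/
@[reducible]
def chabauty (G : Type*) [Group G] : TopologicalSpace (Subgroup G) :=
  TopologicalSpace.induced (fun (H : Subgroup G) (g : G) => decide (g ∈ H))
    (inferInstance : TopologicalSpace (G → Bool))

/-- The conjugacy class of a subgroup. -/
def conjClass (H : Subgroup G) : Set (Subgroup G) :=
  Set.range fun g : G => H.map (MulAut.conj g).toMonoidHom

/-- Subgroups are weakly conjugate if their conjugacy classes have the same closure in the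
Chabauty topology. -/
def WeaklyConjugate (H L : Subgroup G) : Prop :=
  closure[chabauty G] (conjClass H) = closure[chabauty G] (conjClass L)

end Representations

/-! ### Thompson's group `T` -/

/-- The images in `ℝ/ℤ` of the dyadic rationals. -/
def dyadicPoints : Set UnitAddCircle :=
  {z | ∃ (m : ℤ) (n : ℕ), z = (((m : ℝ) / 2 ^ n : ℝ) : UnitAddCircle)}

/-- The images in `ℝ/ℤ` of the rationals. -/
def rationalPoints : Set UnitAddCircle :=
  {z | ∃ q : ℚ, z = ((q : ℝ) : UnitAddCircle)}

/-- `f` is affine near `t`, with slope a power of `2`. -/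
def AffineNear (f : ℝ → ℝ) (t : ℝ) : Prop :=
  ∃ (k : ℤ) (c : ℝ), ∀ᶠ s in 𝓝 t, f s = (2 : ℝ) ^ k * s + c

/-- The condition for a homeomorphism `g` of the circle `ℝ/ℤ` to belong to Thompson's group `T`:
it is orientation preserving, i.e. lifts to an increasing bijection `f` of `ℝ` commuting with
`t ↦ t + 1`; outside a finite set `B` of dyadic points it is locally affine with slopes powers
of `2`; and it maps dyadic points to dyadic points. -/
def IsThompson (g : UnitAddCircle ≃ₜ UnitAddCircle) : Prop :=
  (∃ f : ℝ ≃o ℝ, (∀ t, f (t + 1) = f t + 1) ∧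
    (∀ t : ℝ, ((f t : ℝ) : UnitAddCircle) = g (t : UnitAddCircle)) ∧
    ∃ B : Set UnitAddCircle, B.Finite ∧ B ⊆ dyadicPoints ∧
      ∀ t : ℝ, (t : UnitAddCircle) ∉ B → AffineNear f t) ∧
  ∀ z ∈ dyadicPoints, g z ∈ dyadicPoints

theorem AffineNear.comp {f₁ f₂ : ℝ → ℝ} {t : ℝ} (h₁ : AffineNear f₁ (f₂ t))
    (h₂ : AffineNear f₂ t) (hc : ContinuousAt f₂ t) : AffineNear (fun s => f₁ (f₂ s)) t := by
  obtain ⟨k, c, h₁⟩ := h₁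
  obtain ⟨l, d, h₂⟩ := h₂
  refine ⟨k + l, 2 ^ k * d + c, ?_⟩
  filter_upwards [hc.eventually h₁, h₂] with s hs hs'
  rw [hs, hs', zpow_add₀ two_ne_zero]
  ring

theorem AffineNear.symm {f : ℝ ≃o ℝ} {t : ℝ} (h : AffineNear f (f.symm t)) :
    AffineNear f.symm t := by
  obtain ⟨k, c, h⟩ := h
  refine ⟨-k, -(2 ^ (-k) * c), ?_⟩
  filter_upwards [f.symm.continuous.continuousAt.eventually h] with s hs
  rw [OrderIso.apply_symm_apply] at hs
  have e : (2 : ℝ) ^ (-k) * 2 ^ k = 1 := by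
    rw [← zpow_add₀ two_ne_zero, neg_add_cancel, zpow_zero]
  linear_combination (2 : ℝ) ^ (-k) * (-hs) - f.symm s * e

theorem mem_dyadicPoints_iff {t : ℝ} : (t : UnitAddCircle) ∈ dyadicPoints ↔
    ∃ (m : ℤ) (n : ℕ), t = m / 2 ^ n := by
  constructor
  · rintro ⟨m, n, h⟩
    rw [← sub_eq_zero, ← AddCircle.coe_sub, AddCircle.coe_eq_zero_iff] at h
    obtain ⟨j, hj⟩ := h
    refine ⟨m + j * 2 ^ n, n, ?_⟩
    simp only [zsmul_eq_mul, mul_one] at hj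
    push_cast
    field_simp
    field_simp at hj
    linarith
  · rintro ⟨m, n, rfl⟩
    exact ⟨m, n, rfl⟩

theorem dyadic_sub {s t : ℝ} (hs : ∃ (m : ℤ) (n : ℕ), s = m / 2 ^ n)
    (ht : ∃ (m : ℤ) (n : ℕ), t = m / 2 ^ n) : ∃ (m : ℤ) (n : ℕ), s - t = m / 2 ^ n := by
  obtain ⟨m, n, rfl⟩ := hs
  obtain ⟨m', n', rfl⟩ := ht
  refine ⟨m * 2 ^ n' - m' * 2 ^ n, n + n', ?_⟩
  push_cast
  field_simp
  ring

theorem dyadic_zpow_mul {s : ℝ} (hs : ∃ (m : ℤ) (n : ℕ), s = m / 2 ^ n) (k : ℤ) :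
    ∃ (m : ℤ) (n : ℕ), (2 : ℝ) ^ k * s = m / 2 ^ n := by
  obtain ⟨m, n, rfl⟩ := hs
  obtain ⟨l, rfl | rfl⟩ := k.eq_nat_or_neg
  · refine ⟨2 ^ l * m, n, ?_⟩
    push_cast
    rw [zpow_natCast]
    ring
  · refine ⟨m, l + n, ?_⟩
    rw [zpow_neg, zpow_natCast]
    field_simp
    ring

theorem exists_dyadic_near {P : ℝ → Prop} {t : ℝ} (h : ∀ᶠ s in 𝓝 t, P s) :
    ∃ s, P s ∧ ∃ (m : ℤ) (n : ℕ), s = m / 2 ^ n := by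
  obtain ⟨ε, hε, h⟩ := Metric.eventually_nhds_iff.1 h
  obtain ⟨n, hn⟩ := exists_pow_lt_of_lt_one hε (by norm_num : (1 / 2 : ℝ) < 1)
  refine ⟨⌊t * 2 ^ n⌋ / 2 ^ n, h ?_, _, _, rfl⟩
  have h₁ := Int.floor_le (t * 2 ^ n)
  have h₂ := Int.lt_floor_add_one (t * 2 ^ n)
  have hp : (0 : ℝ) < 2 ^ n := by positivity
  refine lt_of_le_of_lt ?_ hn
  rw [Real.dist_eq, abs_sub_comm, abs_of_nonneg (by rw [sub_nonneg, div_le_iff₀ hp]; exact h₁),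
    one_div, inv_pow, sub_le_iff_le_add, ← one_div, ← add_div, le_div_iff₀ hp]
  linarith

theorem IsThompson.inv {g : UnitAddCircle ≃ₜ UnitAddCircle} (hg : IsThompson g) :
    IsThompson g⁻¹ := by
  obtain ⟨⟨f, f1, fg, B, hB, hBd, hf⟩, hd⟩ := hg
  have fg' : ∀ t : ℝ, ((f.symm t : ℝ) : UnitAddCircle) = g⁻¹ (t : UnitAddCircle) := by
    intro t
    apply g.injective
    rw [← fg, OrderIso.apply_symm_apply]
    exact (g.apply_symm_apply _).symm
  refine ⟨⟨f.symm, fun t => ?_, fg', g '' B, hB.image _, ?_, fun t ht => ?_⟩, fun z hz => ?_⟩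
  · apply f.injective
    rw [f1, OrderIso.apply_symm_apply, OrderIso.apply_symm_apply]
  · rintro _ ⟨z, hz, rfl⟩
    exact hd z (hBd hz)
  · refine AffineNear.symm (hf _ fun h => ht ⟨_, h, ?_⟩)
    rw [← fg, OrderIso.apply_symm_apply]
  · obtain ⟨t, rfl⟩ := QuotientAddGroup.mk_surjective z
    by_cases hb : ((f.symm t : ℝ) : UnitAddCircle) ∈ B
    · have := hBd hb
      rwa [fg'] at this
    · obtain ⟨k, c, hk⟩ := hf _ hb
      obtain ⟨s, hs, hsd⟩ := exists_dyadic_near hk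
      have hfs : ∃ (m : ℤ) (n : ℕ), f s = m / 2 ^ n := by
        rw [← mem_dyadicPoints_iff, fg]
        exact hd _ (mem_dyadicPoints_iff.2 hsd)
      have ht := hk.self_of_nhds
      rw [OrderIso.apply_symm_apply] at ht
      have e : f.symm t = s - 2 ^ (-k) * (f s - t) := by
        have e : (2 : ℝ) ^ (-k) * 2 ^ k = 1 := by
          rw [← zpow_add₀ two_ne_zero, neg_add_cancel, zpow_zero]
        linear_combination (2 : ℝ) ^ (-k) * (hs - ht) + (s - f.symm t) * e
      have hz' := mem_dyadicPoints_iff.1 hz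
      have := mem_dyadicPoints_iff.2 (dyadic_sub hsd (dyadic_zpow_mul (dyadic_sub hfs hz') (-k)))
      rwa [← e, fg'] at this

/-- Thompson's group `T`. -/
def thompsonT : Subgroup (UnitAddCircle ≃ₜ UnitAddCircle) where
  carrier := {g | IsThompson g}
  one_mem' := ⟨⟨OrderIso.refl ℝ, fun _ => rfl, fun _ => rfl, ∅, Set.finite_empty,
    Set.empty_subset _, fun _ _ => ⟨0, 0, by simp⟩⟩, fun _ hz => hz⟩
  mul_mem' := by
    rintro g₁ g₂ ⟨⟨f₁, a₁, b₁, B₁, c₁, d₁, e₁⟩, h₁⟩ hg₂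
    obtain ⟨-, h₂'⟩ := hg₂.inv
    obtain ⟨⟨f₂, a₂, b₂, B₂, c₂, d₂, e₂⟩, h₂⟩ := hg₂
    refine ⟨⟨f₂.trans f₁, fun t => ?_, fun t => ?_, B₂ ∪ g₂.symm '' B₁, c₂.union (c₁.image _), ?_,
      fun t ht => ?_⟩, fun z hz => h₁ _ (h₂ z hz)⟩
    · simp [a₁, a₂]
    · simp only [OrderIso.trans_apply, b₁, b₂]
      rfl
    · rintro z (hz | ⟨w, hw, rfl⟩)
      · exact d₂ hz
      · exact h₂' _ (d₁ hw)
    · have h₃ : ((f₂ t : ℝ) : UnitAddCircle) ∉ B₁ := fun h =>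
        ht (Or.inr ⟨_, h, by rw [b₂]; exact g₂.symm_apply_apply _⟩)
      exact AffineNear.comp (f₂ := f₂) (e₁ _ h₃) (e₂ t fun h => ht (Or.inl h))
        f₂.continuous.continuousAt
  inv_mem' := IsThompson.inv

/-- The action of `T` on the circle. -/
instance : MulAction thompsonT UnitAddCircle where
  smul g z := (g : UnitAddCircle ≃ₜ UnitAddCircle) z
  one_smul _ := rfl
  mul_smul _ _ _ := rfl

theorem smul_def (g : thompsonT) (z : UnitAddCircle) :
    g • z = (g : UnitAddCircle ≃ₜ UnitAddCircle) z := rfl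

end

end ThompsonRep

open ThompsonRep

/-!
The vectors of `Ind_H σ` supported on the coset `H` form a copy of `σ` that generates `Ind_H σ`.
If `σ` is finite dimensional and `A` is an intertwiner from `Ind_H σ` to `Ind_L ρ`, the supremum of
`‖(A v) x‖` over the unit vectors `v` of this copy is constant on the `H`-orbits of the cosets
`xL` and square summable over `G ⧸ L`, so it vanishes on infinite orbits. For stabilizers in `T`,
every orbit of `T_x` on the circle other than `{x}` is infinite, because every nonempty open set
contains the support of some nontrivial element of `T`. Hence an intertwiner from `Ind σ` to
`Ind ρ` is zero if `y ∉ T x`, and after conjugation it comes from an intertwiner from `σ` to `ρ` if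
`y ∈ T x`.

For weak conjugacy, an element of `T` that fixes an irrational point is the identity near that
point, so the map `z ↦ T_z` is continuous at irrational points; and all orbits of `T` are dense.
-/

namespace ThompsonRep

open scoped InnerProductSpace

noncomputable section

section UnitaryRepresentations

variable {G : Type*} [Group G]
  {V : Type*} [NormedAddCommGroup V] [InnerProductSpace ℂ V] (π : G →* (V ≃ₗᵢ[ℂ] V))
  {V' : Type*} [NormedAddCommGroup V'] [InnerProductSpace ℂ V'] {π' : G →* (V' ≃ₗᵢ[ℂ] V')}
  {V'' : Type*} [NormedAddCommGroup V''] [InnerProductSpace ℂ V''] {π'' : G →* (V'' ≃ₗᵢ[ℂ] V'')}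

theorem UnitarilyEquivalent.refl : UnitarilyEquivalent π π :=
  ⟨LinearIsometryEquiv.refl ℂ V, fun _ _ => rfl⟩

variable {π} in
theorem UnitarilyEquivalent.symm (h : UnitarilyEquivalent π π') : UnitarilyEquivalent π' π := by
  obtain ⟨U, hU⟩ := h
  refine ⟨U.symm, fun g w => U.injective ?_⟩
  rw [hU, U.apply_symm_apply, U.apply_symm_apply]

variable {π} in
theorem UnitarilyEquivalent.trans (h : UnitarilyEquivalent π π')
    (h' : UnitarilyEquivalent π' π'') : UnitarilyEquivalent π π'' := by
  obtain ⟨U, hU⟩ := h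
  obtain ⟨U', hU'⟩ := h'
  exact ⟨U.trans U', fun g v => by simp only [LinearIsometryEquiv.trans_apply, hU, hU']⟩

theorem inner_rep_left (g : G) (v w : V) : ⟪π g v, w⟫_ℂ = ⟪v, π g⁻¹ w⟫_ℂ := by
  rw [LinearIsometryEquiv.inner_map_eq_flip, map_inv]
  rfl

theorem rep_mem_orthogonal {W : Submodule ℂ V} (hW : ∀ g : G, ∀ v ∈ W, π g v ∈ W) (g : G) {v : V}
    (hv : v ∈ Wᗮ) : π g v ∈ Wᗮ := by
  refine (W.mem_orthogonal' _).2 fun w hw => ?_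
  rw [inner_rep_left]
  exact (W.mem_orthogonal' _).1 hv _ (hW _ _ hw)

theorem starProjection_rep (W : Submodule ℂ V) [W.HasOrthogonalProjection]
    (hW : ∀ g : G, ∀ v ∈ W, π g v ∈ W) (g : G) (v : V) :
    W.starProjection (π g v) = π g (W.starProjection v) := by
  refine W.eq_starProjection_of_mem_of_inner_eq_zero (hW _ _ (W.starProjection_apply_mem v))
    fun w hw => ?_
  rw [← map_sub, inner_rep_left]
  exact W.starProjection_inner_eq_zero _ _ (hW _ _ hw)

theorem norm_map_le_sum_orthonormalBasis {E F ι : Type*} [NormedAddCommGroup E]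
    [InnerProductSpace ℂ E] [Fintype ι] (b : OrthonormalBasis ι ℂ E) [SeminormedAddCommGroup F]
    [NormedSpace ℂ F] (A : E →ₗ[ℂ] F) (v : E) : ‖A v‖ ≤ (∑ i, ‖A (b i)‖) * ‖v‖ := by
  calc ‖A v‖ = ‖∑ i, ⟪b i, v⟫_ℂ • A (b i)‖ := by
        conv_lhs => rw [← b.sum_repr' v, map_sum]
        simp only [map_smul]
    _ ≤ ∑ i, ‖A (b i)‖ * ‖v‖ := by
        refine norm_sum_le_of_le _ fun i _ => ?_
        rw [norm_smul, mul_comm]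
        gcongr
        simpa using norm_inner_le_norm (𝕜 := ℂ) (b i) v
    _ = (∑ i, ‖A (b i)‖) * ‖v‖ := (Finset.sum_mul _ _ _).symm

end UnitaryRepresentations

/-! ### Vectors supported on the trivial coset -/

namespace IndSpace

variable {G : Type*} [Group G] {H : Subgroup G}
  {K : Type*} [NormedAddCommGroup K] [InnerProductSpace ℂ K]

theorem toFun_add {σ : H →* (K ≃ₗᵢ[ℂ] K)} (F₁ F₂ : IndSpace σ) (x : G) :
    (F₁ + F₂).toFun x = F₁.toFun x + F₂.toFun x := rfl

theorem toFun_smul {σ : H →* (K ≃ₗᵢ[ℂ] K)} (c : ℂ) (F : IndSpace σ) (x : G) :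
    (c • F).toFun x = c • F.toFun x := rfl

variable (σ : H →* (K ≃ₗᵢ[ℂ] K))

/-- Evaluation at `x : G` as a linear map on the space of the induced representation. -/
def eval (x : G) : IndSpace σ →ₗ[ℂ] K where
  toFun F := F.toFun x
  map_add' F₁ F₂ := toFun_add F₁ F₂ x
  map_smul' c F := toFun_smul c F x

theorem out_mem_iff (q : G ⧸ H) : q.out ∈ H ↔ q = (1 : G) := by
  rw [← QuotientGroup.out_eq' q, eq_comm, QuotientGroup.eq, inv_one, one_mul,
    QuotientGroup.out_eq']

open scoped Classical in
/-- The map in `IndSpace σ` that is supported on `H` and takes the value `v` at `1`; these vectors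
form a copy of `σ` inside the restriction of `ind σ` to `H`. -/
def single : K →ₗ[ℂ] IndSpace σ :=
  LinearMap.codRestrict (indSubmodule σ)
    (LinearMap.pi fun x => if hx : x ∈ H then (σ ⟨x, hx⟩⁻¹).toLinearEquiv.toLinearMap else 0)
    fun v => by
      refine ⟨fun x h => ?_, summable_of_ne_finset_zero (s := {((1 : G) : G ⧸ H)})
        fun q hq => ?_⟩
      · by_cases hx : x ∈ H
        · have e : (⟨x * h, H.mul_mem hx h.2⟩ : H)⁻¹ = h⁻¹ * ⟨x, hx⟩⁻¹ := mul_inv_rev ⟨x, hx⟩ h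
          simp only [LinearMap.pi_apply, hx, H.mul_mem hx h.2, dite_true, e, _root_.map_mul]
          rfl
        · simp [hx, H.mul_mem_cancel_right h.2]
      · simp [out_mem_iff, Finset.mem_singleton.not.1 hq]

open scoped Classical in
theorem single_apply (v : K) (x : G) :
    (single σ v).toFun x = if hx : x ∈ H then σ ⟨x, hx⟩⁻¹ v else 0 := by
  change (dite _ _ _ : K →ₗ[ℂ] K) v = _
  split_ifs <;> rfl

theorem single_of_mem (v : K) (h : H) : (single σ v).toFun h = σ h⁻¹ v := by
  rw [single_apply, dif_pos h.2]

theorem single_of_notMem (v : K) {x : G} (hx : x ∉ H) : (single σ v).toFun x = 0 := by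
  rw [single_apply, dif_neg hx]

variable {σ}

theorem eq_single_of_forall_notMem {F : IndSpace σ} (hF : ∀ x ∉ H, F.toFun x = 0) :
    F = single σ (F.toFun 1) := by
  refine toFun_injective <| funext fun x => ?_
  by_cases hx : x ∈ H
  · rw [single_of_mem σ _ ⟨x, hx⟩, ← F.map_mul, one_mul]
  · rw [hF x hx, single_of_notMem σ _ hx]

variable (σ)

theorem ind_single (h : H) (v : K) : ind σ (h : G) (single σ v) = single σ (σ h v) := by
  have e : (ind σ (h : G) (single σ v)).toFun 1 = σ h v := by
    rw [ind_apply, mul_one]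
    simpa using single_of_mem σ v h⁻¹
  rw [← e]
  refine eq_single_of_forall_notMem fun x hx => ?_
  rw [ind_apply, single_of_notMem σ _ ((H.mul_mem_cancel_left (H.inv_mem h.2)).not.2 hx)]

theorem inner_single (v : K) (F : IndSpace σ) : ⟪single σ v, F⟫_ℂ = ⟪v, F.toFun 1⟫_ℂ := by
  have h₁ : ((1 : G) : G ⧸ H).out ∈ H := (out_mem_iff _).2 rfl
  rw [inner_eq_tsum, tsum_eq_single ((1 : G) : G ⧸ H) fun q hq => by
    rw [single_of_notMem σ v ((out_mem_iff q).not.2 hq), inner_zero_left]]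
  obtain ⟨h, hh⟩ : ∃ h : H, (h : G) = ((1 : G) : G ⧸ H).out := ⟨⟨_, h₁⟩, rfl⟩
  rw [← hh, single_of_mem, ← one_mul (h : G), F.map_mul, LinearIsometryEquiv.inner_map_map]

theorem inner_ind_single (g : G) (v : K) (F : IndSpace σ) :
    ⟪ind σ g (single σ v), F⟫_ℂ = ⟪v, F.toFun g⟫_ℂ := by
  rw [inner_rep_left, inner_single, ind_apply, inv_inv, mul_one]

theorem single_one (v : K) : (single σ v).toFun 1 = v := by
  simpa using single_of_mem σ v 1

theorem norm_single (v : K) : ‖single σ v‖ = ‖v‖ := by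
  rw [← sq_eq_sq₀ (norm_nonneg _) (norm_nonneg _), ← inner_self_eq_norm_sq (𝕜 := ℂ), inner_single,
    single_one, inner_self_eq_norm_sq]

variable {σ}

theorem eq_bot_of_single_mem_orthogonal {W : Submodule ℂ (IndSpace σ)}
    (hW : ∀ g : G, ∀ F ∈ W, ind σ g F ∈ W) (h : ∀ v, single σ v ∈ Wᗮ) : W = ⊥ := by
  refine W.eq_bot_iff.2 fun F hF => toFun_injective <| funext fun x => ?_
  refine (ext_inner_left ℂ fun v => ?_ : F.toFun x = 0)
  rw [← inner_ind_single, inner_rep_left, (W.mem_orthogonal' _).1 (h v) _ (hW _ _ hF),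
    inner_zero_right]

theorem eq_top_of_single_mem {W : Submodule ℂ (IndSpace σ)} [W.HasOrthogonalProjection]
    (hW : ∀ g : G, ∀ F ∈ W, ind σ g F ∈ W) (h : ∀ v, single σ v ∈ W) : W = ⊤ :=
  W.orthogonal_eq_bot_iff.1 <| eq_bot_of_single_mem_orthogonal
    (fun g _ hF => rep_mem_orthogonal (ind σ) hW g hF) fun v => W.le_orthogonal_orthogonal (h v)

theorem tendsto_norm_out (F : IndSpace σ) :
    Tendsto (fun q : G ⧸ H => ‖F.toFun q.out‖) cofinite (𝓝 0) := by
  have h : Tendsto (fun q : G ⧸ H => √(‖F.toFun q.out‖ ^ 2)) cofinite (𝓝 √0) :=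
    F.2.2.tendsto_cofinite_zero.sqrt
  simpa using h

end IndSpace

/-! ### Intertwiners between induced representations -/

section Intertwiners

open IndSpace

variable {G : Type*} [Group G] {H L : Subgroup G}
  {K : Type*} [NormedAddCommGroup K] [InnerProductSpace ℂ K]
  {K' : Type*} [NormedAddCommGroup K'] [InnerProductSpace ℂ K']
  {σ : H →* (K ≃ₗᵢ[ℂ] K)}

theorem norm_apply_single_smul {ρ : L →* (K' ≃ₗᵢ[ℂ] K')} {A : IndSpace σ →ₗ[ℂ] IndSpace ρ}
    (hA : ∀ (g : G) (F : IndSpace σ), A (ind σ g F) = ind ρ g (A F)) (v : K) (g : G) (h : H) :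
    ‖(A (single σ (σ h v))).toFun (h • (g : G ⧸ L)).out‖ = ‖(A (single σ v)).toFun g‖ := by
  have e : h • (g : G ⧸ L) = ((h * g : G) : G ⧸ L) := rfl
  rw [← ind_single, hA, e, norm_out, ind_apply, inv_mul_cancel_left]

/-- As `h` runs through `H`, the value at `hg` of the image of `single σ (σ h v)` has constant
norm, although by finite-dimensionality it is dominated by a square-summable function of the
coset `hgL`. -/
theorem apply_single_eq_zero [FiniteDimensional ℂ K] {ρ : L →* (K' ≃ₗᵢ[ℂ] K')}
    {A : IndSpace σ →ₗ[ℂ] IndSpace ρ}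
    (hA : ∀ (g : G) (F : IndSpace σ), A (ind σ g F) = ind ρ g (A F)) {g : G}
    (hg : (MulAction.orbit H (g : G ⧸ L)).Infinite) (v : K) : (A (single σ v)).toFun g = 0 := by
  let b := stdOrthonormalBasis ℂ K
  let C (q : G ⧸ L) : ℝ := (∑ i, ‖(A (single σ (b i))).toFun q.out‖) * ‖v‖
  have hC : Tendsto C cofinite (𝓝 0) := by
    simpa using (tendsto_finsetSum _ fun i _ => tendsto_norm_out (A (single σ (b i)))).mul_const ‖v‖
  have hle : ∀ q ∈ MulAction.orbit H (g : G ⧸ L), ‖(A (single σ v)).toFun g‖ ≤ C q := by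
    rintro _ ⟨h, rfl⟩
    have := norm_map_le_sum_orthonormalBasis b
      (eval ρ (h • (g : G ⧸ L)).out ∘ₗ A ∘ₗ single σ) (σ h v)
    rw [LinearIsometryEquiv.norm_map] at this
    exact (norm_apply_single_smul hA v g h).symm.trans_le this
  have := hg.cofinite_inf_principal_neBot
  exact norm_le_zero_iff.1 <| ge_of_tendsto (hC.mono_left inf_le_left) <|
    mem_inf_of_right (mem_principal.2 hle)

theorem apply_single [FiniteDimensional ℂ K] {ρ : H →* (K' ≃ₗᵢ[ℂ] K')}
    (hH : ∀ g ∉ H, (MulAction.orbit H (g : G ⧸ H)).Infinite) {A : IndSpace σ →ₗ[ℂ] IndSpace ρ}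
    (hA : ∀ (g : G) (F : IndSpace σ), A (ind σ g F) = ind ρ g (A F)) (v : K) :
    A (single σ v) = single ρ ((A (single σ v)).toFun 1) :=
  eq_single_of_forall_notMem fun g hg => apply_single_eq_zero hA (hH g hg) v

theorem exists_finite_orbit_of_unitarilyEquivalent_ind [FiniteDimensional ℂ K] [Nontrivial K]
    {ρ : L →* (K' ≃ₗᵢ[ℂ] K')} (h : UnitarilyEquivalent (ind σ) (ind ρ)) :
    ∃ g : G, (MulAction.orbit H (g : G ⧸ L)).Finite := by
  obtain ⟨U, hU⟩ := h
  obtain ⟨v, hv⟩ := exists_ne (0 : K)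
  by_contra! hinf
  have hUv : U (single σ v) = 0 := toFun_injective <| funext fun g =>
    apply_single_eq_zero (A := U.toLinearEquiv.toLinearMap) hU (hinf g) v
  rw [← norm_eq_zero, U.norm_map, norm_single, norm_eq_zero] at hUv
  exact hv hUv

/-- Mackey's irreducibility criterion. The projection onto a closed invariant subspace is an
intertwiner, so it preserves the copy of `σ` formed by the vectors `single σ v`. -/
theorem isIrreducibleRep_ind [FiniteDimensional ℂ K]
    (hH : ∀ g ∉ H, (MulAction.orbit H (g : G ⧸ H)).Infinite) (hσ : IsIrreducibleRep σ) :
    IsIrreducibleRep (ind σ) := by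
  obtain ⟨hK, hσ⟩ := hσ
  have hsingle : Isometry (single σ) := AddMonoidHomClass.isometry_of_norm _ (norm_single σ)
  refine ⟨hsingle.injective.nontrivial, fun W hWc hW => ?_⟩
  have : CompleteSpace W := hWc.completeSpace_coe
  rcases hσ (W.comap (single σ)) (hWc.preimage hsingle.continuous) fun h v hv => by
    rw [Submodule.mem_comap, ← ind_single]
    exact hW _ _ hv with hbot | htop
  · refine .inl (eq_bot_of_single_mem_orthogonal hW fun v => ?_)
    have hP := apply_single hH (A := W.starProjection.toLinearMap) (starProjection_rep _ W hW) v
    have h₀ : (W.starProjection (single σ v)).toFun 1 = 0 := by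
      rw [← Submodule.mem_bot ℂ, ← hbot, Submodule.mem_comap]
      exact hP ▸ W.starProjection_apply_mem _
    rw [← W.starProjection_apply_eq_zero_iff]
    exact hP.trans (by rw [ContinuousLinearMap.coe_coe, h₀, map_zero])
  · exact .inr (eq_top_of_single_mem hW fun v =>
      Submodule.mem_comap.1 (htop ▸ Submodule.mem_top))

theorem unitarilyEquivalent_of_ind [FiniteDimensional ℂ K] {ρ : H →* (K' ≃ₗᵢ[ℂ] K')}
    (hH : ∀ g ∉ H, (MulAction.orbit H (g : G ⧸ H)).Infinite)
    (h : UnitarilyEquivalent (ind σ) (ind ρ)) : UnitarilyEquivalent σ ρ := by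
  obtain ⟨U, hU⟩ := h
  let B : K →ₗ[ℂ] K' := eval ρ 1 ∘ₗ U.toLinearEquiv.toLinearMap ∘ₗ single σ
  have hB (v : K) : U (single σ v) = single ρ (B v) :=
    apply_single hH (A := U.toLinearEquiv.toLinearMap) hU v
  have hB_norm (v : K) : ‖B v‖ = ‖v‖ := by
    rw [← norm_single ρ, ← hB, U.norm_map, norm_single]
  have hB_comm (h : H) (v : K) : B (σ h v) = ρ h (B v) := by
    rw [← single_one ρ (B _), ← hB, ← ind_single, hU, hB, ind_single, single_one]
  have hB_surj : Function.Surjective B := fun w => by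
    obtain ⟨F, hF⟩ := U.surjective (single ρ w)
    have hF₀ : ∀ x ∉ H, F.toFun x = 0 := fun x hx => by
      refine ext_inner_left ℂ fun v => ?_
      rw [← inner_ind_single, ← U.inner_map_map, hU, hB, hF, inner_ind_single,
        single_of_notMem ρ w hx, inner_zero_right, inner_zero_right]
    refine ⟨F.toFun 1, ?_⟩
    rw [← single_one ρ (B _), ← hB, ← eq_single_of_forall_notMem hF₀, hF, single_one]
  exact ⟨LinearIsometryEquiv.ofSurjective ⟨B, hB_norm⟩ hB_surj, hB_comm⟩

end Intertwiners

/-! ### Conjugation of the inducing subgroup -/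

section Conjugation

open IndSpace

variable {G : Type*} [Group G] {H L : Subgroup G}
  {K : Type*} [NormedAddCommGroup K] [InnerProductSpace ℂ K]
  {K' : Type*} [NormedAddCommGroup K'] [InnerProductSpace ℂ K']
  {σ : H →* (K ≃ₗᵢ[ℂ] K)} {ρ : L →* (K' ≃ₗᵢ[ℂ] K')}

theorem IndSpace.hasSum_norm_sq {ι : Type*} (F : IndSpace σ) (e : ι ≃ G ⧸ H) {s : ι → G}
    (hs : ∀ i, (s i : G ⧸ H) = e i) : HasSum (fun i => ‖F.toFun (s i)‖ ^ 2) (‖F‖ ^ 2) := by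
  rw [norm_sq_eq_tsum]
  refine (e.hasSum_iff.2 (Summable.hasSum F.2.2)).congr_fun fun i => ?_
  change _ = ‖F.toFun (e i).out‖ ^ 2
  rw [← hs, norm_out]

/-- The bijection `xL ↦ xg⁻¹H` between the cosets of `L = g⁻¹Hg` and those of `H`. -/
def cosetEquiv {g : G} (hg : ∀ l, l ∈ L ↔ g * l * g⁻¹ ∈ H) : G ⧸ L ≃ G ⧸ H :=
  Quotient.congr (Equiv.mulRight g⁻¹) fun a b => by
    simp only [QuotientGroup.leftRel_apply, hg, Equiv.coe_mulRight, mul_inv_rev, inv_inv, mul_assoc]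

theorem cosetEquiv_mk {g : G} (hg : ∀ l, l ∈ L ↔ g * l * g⁻¹ ∈ H) (x : G) :
    cosetEquiv hg (x : G ⧸ L) = (x * g⁻¹ : G) := rfl

/-- The map `F ↦ (x ↦ T (F (x g⁻¹)))` from `Ind σ` to `Ind ρ`, where `ρ` is a representation of
`g⁻¹Hg` and `T` intertwines `σ^g` and `ρ`. -/
def indTranslateRight {g : G} (hg : ∀ l, l ∈ L ↔ g * l * g⁻¹ ∈ H) {T : K ≃ₗᵢ[ℂ] K'}
    (hT : ∀ (l : L) (v : K), T (σ ⟨g * l * g⁻¹, (hg l).1 l.2⟩ v) = ρ l (T v)) :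
    IndSpace σ →ₗᵢ[ℂ] IndSpace ρ :=
  have hsum (F : IndSpace σ) : HasSum (fun q : G ⧸ L => ‖T (F.toFun (q.out * g⁻¹))‖ ^ 2)
      (‖F‖ ^ 2) := by
    simp only [LinearIsometryEquiv.norm_map]
    exact F.hasSum_norm_sq (cosetEquiv hg) fun q => by
      rw [← cosetEquiv_mk hg, QuotientGroup.out_eq']
  { toFun F :=
      { val x := T (F.toFun (x * g⁻¹))
        property := by
          refine ⟨fun x l => ?_, (hsum F).summable⟩
          have hx : x * l * g⁻¹ = x * g⁻¹ * (g * l * g⁻¹) := by group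
          have hl : (⟨g * l * g⁻¹, (hg l).1 l.2⟩ : H)⁻¹ =
              ⟨g * (l⁻¹ : L) * g⁻¹, (hg _).1 (l⁻¹ : L).2⟩ := by ext; simp [mul_assoc]
          change T (F.toFun (x * l * g⁻¹)) = ρ l⁻¹ (T (F.toFun (x * g⁻¹)))
          rw [hx, F.map_mul (x * g⁻¹) ⟨g * l * g⁻¹, (hg l).1 l.2⟩, hl, hT] }
    map_add' F₁ F₂ := toFun_injective <| funext fun x => map_add T _ _
    map_smul' c F := toFun_injective <| funext fun x => map_smul T c _
    norm_map' F := by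
      rw [← sq_eq_sq₀ (norm_nonneg _) (norm_nonneg _), IndSpace.norm_sq_eq_tsum]
      exact (hsum F).tsum_eq }

theorem indTranslateRight_apply {g : G} (hg : ∀ l, l ∈ L ↔ g * l * g⁻¹ ∈ H) {T : K ≃ₗᵢ[ℂ] K'}
    (hT : ∀ (l : L) (v : K), T (σ ⟨g * l * g⁻¹, (hg l).1 l.2⟩ v) = ρ l (T v)) (F : IndSpace σ)
    (x : G) : (indTranslateRight hg hT F).toFun x = T (F.toFun (x * g⁻¹)) := rfl

theorem indTranslateRight_surjective {g : G} (hg : ∀ l, l ∈ L ↔ g * l * g⁻¹ ∈ H)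
    {T : K ≃ₗᵢ[ℂ] K'}
    (hT : ∀ (l : L) (v : K), T (σ ⟨g * l * g⁻¹, (hg l).1 l.2⟩ v) = ρ l (T v)) :
    Function.Surjective (indTranslateRight hg hT) := fun E => by
  have hg' (h : G) : h ∈ H ↔ g⁻¹ * h * g⁻¹⁻¹ ∈ L := by simp [hg, mul_assoc]
  have hT' (h : H) (w : K') :
      T.symm (ρ ⟨g⁻¹ * h * g⁻¹⁻¹, (hg' h).1 h.2⟩ w) = σ h (T.symm w) := by
    obtain ⟨v, rfl⟩ := T.surjective w
    rw [← hT, T.symm_apply_apply, T.symm_apply_apply]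
    congr 2
    ext
    simp [mul_assoc]
  refine ⟨indTranslateRight hg' hT' E, toFun_injective <| funext fun x => ?_⟩
  simp only [indTranslateRight_apply, T.apply_symm_apply, inv_inv, inv_mul_cancel_right]

theorem unitarilyEquivalent_ind {g : G} {hL : L = H.map (MulAut.conj g⁻¹).toMonoidHom}
    (h : UnitarilyEquivalent (conjRep g hL σ) ρ) : UnitarilyEquivalent (ind σ) (ind ρ) := by
  obtain ⟨T, hT⟩ := h
  have hg (l : G) : l ∈ L ↔ g * l * g⁻¹ ∈ H := by
    rw [hL]
    exact Subgroup.mem_map_equiv.trans (by simp)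
  refine ⟨.ofSurjective _ (indTranslateRight_surjective hg hT), fun a F =>
    toFun_injective <| funext fun x => ?_⟩
  change T (F.toFun (a⁻¹ * (x * g⁻¹))) = T (F.toFun (a⁻¹ * x * g⁻¹))
  rw [mul_assoc]

theorem unitarilyEquivalent_ind_iff [FiniteDimensional ℂ K]
    (hLc : ∀ a ∉ L, (MulAction.orbit L (a : G ⧸ L)).Infinite) {g : G}
    (hL : L = H.map (MulAut.conj g⁻¹).toMonoidHom) :
    UnitarilyEquivalent (ind σ) (ind ρ) ↔ UnitarilyEquivalent (conjRep g hL σ) ρ :=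
  ⟨fun h => unitarilyEquivalent_of_ind hLc <|
    (unitarilyEquivalent_ind (UnitarilyEquivalent.refl (conjRep g hL σ))).symm.trans h,
    unitarilyEquivalent_ind⟩

end Conjugation

/-! ### Stabilizers of a group action -/

section Stabilizers

open MulAction

variable {G X : Type*} [Group G] [MulAction G X] {x y : X}

theorem infinite_orbit_mk_stabilizer {H : Subgroup G} {g : G} (h : (orbit H (g • y)).Infinite) :
    (orbit H (g : G ⧸ stabilizer G y)).Infinite := by
  refine Set.Infinite.of_image (ofQuotientStabilizer G y) (h.mono ?_)
  rintro _ ⟨k, rfl⟩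
  exact ⟨_, mem_orbit _ k, ofQuotientStabilizer_smul G y (k : G) (g : G ⧸ stabilizer G y)⟩

section Representations

variable {K : Type*} [NormedAddCommGroup K] [InnerProductSpace ℂ K] [FiniteDimensional ℂ K]
  {K' : Type*} [NormedAddCommGroup K'] [InnerProductSpace ℂ K']
  {σ : stabilizer G x →* (K ≃ₗᵢ[ℂ] K)} {ρ : stabilizer G y →* (K' ≃ₗᵢ[ℂ] K')}

theorem isIrreducibleRep_ind_stabilizer
    (hx : ∀ z ≠ x, (orbit (stabilizer G x) z).Infinite) (hσ : IsIrreducibleRep σ) :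
    IsIrreducibleRep (ind σ) :=
  isIrreducibleRep_ind (fun _ hg => infinite_orbit_mk_stabilizer (hx _ hg)) hσ

theorem mem_orbit_of_unitarilyEquivalent_ind [Nontrivial K]
    (hx : ∀ z ≠ x, (orbit (stabilizer G x) z).Infinite)
    (h : UnitarilyEquivalent (ind σ) (ind ρ)) : y ∈ orbit G x := by
  obtain ⟨g, hg⟩ := exists_finite_orbit_of_unitarilyEquivalent_ind h
  by_contra hy
  refine infinite_orbit_mk_stabilizer (hx (g • y) fun hgy => hy ?_) hg
  exact (orbit_eq_iff.1 (orbit_smul g y ▸ congrArg (orbit G) hgy) : y ∈ orbit G x)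

theorem unitarilyEquivalent_ind_stabilizer_iff [Nontrivial K]
    (hx : ∀ z ≠ x, (orbit (stabilizer G x) z).Infinite)
    (hy : ∀ z ≠ y, (orbit (stabilizer G y) z).Infinite) :
    UnitarilyEquivalent (ind σ) (ind ρ) ↔
      ∃ (g : G) (h : g • x = y), UnitarilyEquivalent ρ (conjRep g⁻¹ (stabilizer_eq_conj h) σ) := by
  have hequiv {g : G} (h : g • x = y) := unitarilyEquivalent_ind_iff (σ := σ) (ρ := ρ)
    (fun _ ha => infinite_orbit_mk_stabilizer (hy _ ha)) (stabilizer_eq_conj h)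
  constructor
  · intro hind
    obtain ⟨g, hg⟩ := mem_orbit_of_unitarilyEquivalent_ind hx hind
    exact ⟨g, hg, ((hequiv hg).1 hind).symm⟩
  · rintro ⟨g, hg, hρ⟩
    exact (hequiv hg).2 hρ.symm

theorem not_repEquivalent_stabilizer (hx : ∀ z ≠ x, (orbit (stabilizer G x) z).Infinite)
    (hy : y ∉ orbit G x) : ¬ RepEquivalent (stabilizer G x) (stabilizer G y) :=
  fun h => hy (mem_orbit_of_unitarilyEquivalent_ind hx h)

end Representations

theorem tendsto_nhds_chabauty_iff {ι : Type*} {l : Filter ι} {S : ι → Subgroup G}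
    {L : Subgroup G} :
    Tendsto S l (@nhds _ (chabauty G) L) ↔ ∀ g, ∀ᶠ i in l, (g ∈ S i ↔ g ∈ L) := by
  simp only [nhds_induced, tendsto_comap_iff, tendsto_pi_nhds, nhds_discrete,
    tendsto_pure, Function.comp_apply, decide_eq_decide]

theorem conjClass_stabilizer (x : X) :
    conjClass (stabilizer G x) = Set.range fun g : G => stabilizer G (g • x) := by
  simp only [conjClass, stabilizer_smul_eq_stabilizer_map_conj]

variable [TopologicalSpace X]

theorem infinite_orbit_stabilizer [T1Space X]
    (h : ∀ U ∈ 𝓝 y, ∃ g : G, g • y ≠ y ∧ ∀ w ∉ U, g • w = w) (hxy : y ≠ x) :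
    (orbit (stabilizer G x) y).Infinite := by
  intro hfin
  let S := insert x (orbit (stabilizer G x) y \ {y})
  have hS : Sᶜ ∈ 𝓝 y :=
    (hfin.sdiff.insert x).isClosed.isOpen_compl.mem_nhds (by simp [hxy])
  obtain ⟨g, hgy, hg⟩ := h _ hS
  have hgx : g • x = x := hg x (by simp [S])
  have hgy' : g • y ∈ S := .inr ⟨⟨⟨g, hgx⟩, rfl⟩, hgy⟩
  exact hgy (smul_left_cancel g (hg (g • y) (by simpa using hgy')))

variable [ContinuousConstSMul G X]

theorem eventually_smul_eq_of_mem_stabilizer_smul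
    (hy : ∀ g ∈ stabilizer G y, ∀ᶠ w in 𝓝 y, g • w = w) (k : G) :
    ∀ g ∈ stabilizer G (k • y), ∀ᶠ w in 𝓝 (k • y), g • w = w := by
  intro g hg
  have hconj : k⁻¹ * g * k ∈ stabilizer G y := by
    rw [mem_stabilizer_iff, mul_smul, mul_smul, hg, inv_smul_smul]
  have hcont : Tendsto (k⁻¹ • ·) (𝓝 (k • y)) (𝓝 y) := by
    simpa using (continuous_const_smul k⁻¹).tendsto (k • y)
  filter_upwards [hcont.eventually (hy _ hconj)] with w hw
  rw [mul_smul, mul_smul, smul_inv_smul] at hw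
  exact smul_left_cancel _ hw

theorem tendsto_stabilizer_chabauty [T2Space X]
    (hy : ∀ g ∈ stabilizer G y, ∀ᶠ w in 𝓝 y, g • w = w) :
    Tendsto (stabilizer G) (𝓝 y) (@nhds _ (chabauty G) (stabilizer G y)) := by
  refine tendsto_nhds_chabauty_iff.2 fun g => ?_
  by_cases hg : g ∈ stabilizer G y
  · filter_upwards [hy g hg] with w hw using iff_of_true hw hg
  · have hopen : IsOpen {w : X | g • w ≠ w} := isOpen_ne_fun (by fun_prop) (by fun_prop)
    filter_upwards [hopen.mem_nhds hg] with w hw using iff_of_false hw hg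

theorem conjClass_stabilizer_subset_closure [T2Space X] (hx : Dense (orbit G x))
    (hy : ∀ g ∈ stabilizer G y, ∀ᶠ w in 𝓝 y, g • w = w) :
    conjClass (stabilizer G y) ⊆ closure[chabauty G] (conjClass (stabilizer G x)) := by
  let := chabauty G
  simp only [conjClass_stabilizer]
  rintro _ ⟨k, rfl⟩
  have : (𝓝[orbit G x] (k • y)).NeBot := mem_closure_iff_nhdsWithin_neBot.1 (hx (k • y))
  have htendsto : Tendsto (stabilizer G) (𝓝[orbit G x] (k • y)) (𝓝 (stabilizer G (k • y))) :=
    (tendsto_stabilizer_chabauty (eventually_smul_eq_of_mem_stabilizer_smul hy k)).mono_left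
      nhdsWithin_le_nhds
  refine mem_closure_of_tendsto htendsto ?_
  filter_upwards [self_mem_nhdsWithin] with _ ⟨g, hg⟩ using ⟨g, congrArg (stabilizer G) hg⟩

theorem weaklyConjugate_stabilizer [T2Space X] [IsMinimal G X]
    (hx : ∀ g ∈ stabilizer G x, ∀ᶠ w in 𝓝 x, g • w = w)
    (hy : ∀ g ∈ stabilizer G y, ∀ᶠ w in 𝓝 y, g • w = w) :
    WeaklyConjugate (stabilizer G x) (stabilizer G y) := by
  let := chabauty G
  exact (closure_minimal (conjClass_stabilizer_subset_closure (dense_orbit G y) hx)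
    isClosed_closure).antisymm (closure_minimal
      (conjClass_stabilizer_subset_closure (dense_orbit G x) hy) isClosed_closure)

end Stabilizers

/-! ### Homeomorphisms of the circle given by lifts -/

section Lifts

/-- The ring `ℤ[1/2]` of dyadic rationals, as a subring of `ℝ`. -/
def dyadic : Subring ℝ where
  carrier := {t | ∃ (m : ℤ) (n : ℕ), t = m / 2 ^ n}
  mul_mem' := by
    rintro _ _ ⟨m, n, rfl⟩ ⟨m', n', rfl⟩
    exact ⟨m * m', n + n', by push_cast; rw [pow_add, div_mul_div_comm]⟩
  one_mem' := ⟨1, 0, by simp⟩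
  add_mem' := by
    rintro _ _ ⟨m, n, rfl⟩ ⟨m', n', rfl⟩
    refine ⟨m * 2 ^ n' + 2 ^ n * m', n + n', ?_⟩
    push_cast
    rw [pow_add, div_add_div _ _ (by positivity) (by positivity)]
  zero_mem' := ⟨0, 0, by simp⟩
  neg_mem' := by
    rintro _ ⟨m, n, rfl⟩
    exact ⟨-m, n, by push_cast; rw [neg_div]⟩

theorem coe_mem_dyadicPoints {t : ℝ} : (t : UnitAddCircle) ∈ dyadicPoints ↔ t ∈ dyadic :=
  mem_dyadicPoints_iff

theorem zpow_mul_mem_dyadic {s : ℝ} (hs : s ∈ dyadic) (k : ℤ) : (2 : ℝ) ^ k * s ∈ dyadic :=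
  dyadic_zpow_mul hs k

theorem dense_dyadic : Dense (dyadic : Set ℝ) := fun _ =>
  mem_closure_iff_frequently.2 fun h =>
    let ⟨_, hs, hsd⟩ := exists_dyadic_near h
    hs hsd

theorem dyadicPoints_subset_rationalPoints : dyadicPoints ⊆ rationalPoints := by
  rintro _ ⟨m, n, rfl⟩
  exact ⟨m / 2 ^ n, by push_cast; rfl⟩

theorem coe_add_intCast (t : ℝ) (m : ℤ) : ((t + m : ℝ) : UnitAddCircle) = t := by
  rw [AddCircle.coe_add, add_eq_left, AddCircle.coe_eq_zero_iff]
  exact ⟨m, by simp⟩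

theorem exists_int_of_coe_eq {s t : ℝ} (h : (s : UnitAddCircle) = t) : ∃ m : ℤ, s = t + m := by
  rw [← sub_eq_zero, ← AddCircle.coe_sub, AddCircle.coe_eq_zero_iff] at h
  obtain ⟨m, hm⟩ := h
  exact ⟨m, by simpa [sub_eq_iff_eq_add'] using hm.symm⟩

theorem periodic_coe_of_map_add_one {f : ℝ → ℝ} (hf : ∀ t, f (t + 1) = f t + 1) :
    Function.Periodic (fun t => (f t : UnitAddCircle)) 1 := fun t => by
  simp [hf]

theorem symm_add_one {f : ℝ ≃o ℝ} (hf : ∀ t, f (t + 1) = f t + 1) (t : ℝ) :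
    f.symm (t + 1) = f.symm t + 1 := by
  rw [OrderIso.symm_apply_eq, hf, OrderIso.apply_symm_apply]

/-- The homeomorphism of `ℝ/ℤ` that lifts to `f`. -/
def circleHomeo (f : ℝ ≃o ℝ) (hf : ∀ t, f (t + 1) = f t + 1) : UnitAddCircle ≃ₜ UnitAddCircle where
  toFun := (periodic_coe_of_map_add_one hf).lift
  invFun := (periodic_coe_of_map_add_one (symm_add_one hf)).lift
  left_inv z := by
    obtain ⟨t, rfl⟩ := QuotientAddGroup.mk_surjective z
    rw [Function.Periodic.lift_coe, Function.Periodic.lift_coe, OrderIso.symm_apply_apply]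
  right_inv z := by
    obtain ⟨t, rfl⟩ := QuotientAddGroup.mk_surjective z
    rw [Function.Periodic.lift_coe, Function.Periodic.lift_coe, OrderIso.apply_symm_apply]
  continuous_toFun := continuous_quot_lift _ ((AddCircle.continuous_mk' 1).comp f.continuous)
  continuous_invFun := continuous_quot_lift _ ((AddCircle.continuous_mk' 1).comp f.symm.continuous)

theorem circleHomeo_coe (f : ℝ ≃o ℝ) (hf : ∀ t, f (t + 1) = f t + 1) (t : ℝ) :
    circleHomeo f hf (t : UnitAddCircle) = (f t : UnitAddCircle) := rfl

theorem isThompson_circleHomeo {f : ℝ ≃o ℝ} (hf : ∀ t, f (t + 1) = f t + 1)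
    {B : Set UnitAddCircle} (hB : B.Finite) (hBd : B ⊆ dyadicPoints)
    (ha : ∀ t : ℝ, (t : UnitAddCircle) ∉ B → AffineNear f t)
    (hd : ∀ t ∈ dyadic, f t ∈ dyadic) : IsThompson (circleHomeo f hf) := by
  refine ⟨⟨f, hf, fun t => (circleHomeo_coe f hf t).symm, B, hB, hBd, ha⟩, fun z hz => ?_⟩
  obtain ⟨t, rfl⟩ := QuotientAddGroup.mk_surjective z
  exact coe_mem_dyadicPoints.2 (hd t (coe_mem_dyadicPoints.1 hz))

theorem exists_rotation_mem_thompsonT {d : ℝ} (hd : d ∈ dyadic) :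
    ∃ g : thompsonT, ∀ t : ℝ, g • (t : UnitAddCircle) = (t + d : ℝ) :=
  ⟨⟨circleHomeo (OrderIso.addRight d) fun t => add_right_comm t 1 d,
    isThompson_circleHomeo _ Set.finite_empty (Set.empty_subset _) (fun _ _ => ⟨0, d, by simp⟩)
      fun _ ht => dyadic.add_mem ht hd⟩, fun _ => rfl⟩

instance : ContinuousConstSMul thompsonT UnitAddCircle :=
  ⟨fun g => (g : UnitAddCircle ≃ₜ UnitAddCircle).continuous⟩

instance : MulAction.IsMinimal thompsonT UnitAddCircle where
  dense_orbit z := by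
    obtain ⟨t, rfl⟩ := QuotientAddGroup.mk_surjective z
    have hrot : DenseRange fun d : ℝ => ((t + d : ℝ) : UnitAddCircle) :=
      (QuotientAddGroup.mk_surjective.comp (add_left_surjective t)).denseRange
    have hcont : Continuous fun d : ℝ => ((t + d : ℝ) : UnitAddCircle) :=
      (AddCircle.continuous_mk' 1).comp (continuous_const_add t)
    refine (hrot.dense_image hcont dense_dyadic).mono ?_
    rintro _ ⟨d, hd, rfl⟩
    obtain ⟨g, hg⟩ := exists_rotation_mem_thompsonT hd
    exact ⟨g, hg t⟩

theorem AffineNear.exists_dyadic_intercept {f : ℝ → ℝ} {t : ℝ} (h : AffineNear f t)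
    (hd : ∀ s ∈ dyadic, f s ∈ dyadic) :
    ∃ k : ℤ, ∃ c ∈ dyadic, ∀ᶠ s in 𝓝 t, f s = (2 : ℝ) ^ k * s + c := by
  obtain ⟨k, c, h⟩ := h
  obtain ⟨s, hs, hsd⟩ := exists_dyadic_near h
  refine ⟨k, c, ?_, h⟩
  rw [← sub_eq_of_eq_add' hs]
  exact dyadic.sub_mem (hd s hsd) (zpow_mul_mem_dyadic hsd k)

/-- If `f s = 2 ^ k * s + c` near an irrational lift `t` and `f t = t + m`, then `2 ^ k = 1`,
since otherwise `t = (m - c) / (2 ^ k - 1)` would be rational. -/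
theorem eventually_smul_eq_of_notMem_rationalPoints {g : thompsonT} {z : UnitAddCircle}
    (hz : z ∉ rationalPoints) (hg : g • z = z) : ∀ᶠ w in 𝓝 z, g • w = w := by
  obtain ⟨t, rfl⟩ := QuotientAddGroup.mk_surjective z
  obtain ⟨⟨f, -, hfg, B, -, hBd, hB⟩, hd⟩ := g.2
  have hfd (s : ℝ) (hs : s ∈ dyadic) : f s ∈ dyadic := by
    rw [← coe_mem_dyadicPoints, hfg]
    exact hd _ (coe_mem_dyadicPoints.2 hs)
  obtain ⟨k, _, ⟨a, n, rfl⟩, hk⟩ :=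
    (hB t fun h => hz (dyadicPoints_subset_rationalPoints (hBd h))).exists_dyadic_intercept hfd
  obtain ⟨m, hm⟩ : ∃ m : ℤ, f t = t + m := exists_int_of_coe_eq ((hfg t).trans hg)
  have hk₁ : (2 : ℝ) ^ k = 1 := by
    by_contra hne
    refine hz ⟨(m - a / 2 ^ n) / (2 ^ k - 1), congrArg _ ?_⟩
    push_cast
    rw [eq_div_iff (sub_ne_zero.2 hne)]
    linear_combination hm - hk.self_of_nhds
  have hc : (a / 2 ^ n : ℝ) = m := by
    linear_combination hm - hk.self_of_nhds - t * hk₁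
  rw [QuotientAddGroup.nhds_eq, eventually_map]
  filter_upwards [hk] with s hs
  change (g : UnitAddCircle ≃ₜ UnitAddCircle) (s : UnitAddCircle) = (s : UnitAddCircle)
  rw [← hfg, hs, hk₁, one_mul, hc, coe_add_intCast]

end Lifts

/-! ### Elements of `T` with small support -/

section SmallSupport

/-- For `0 < c`, the standard generator `x₀` of Thompson's group `F`, rescaled to `[0, c]` and
extended by the identity: the slopes on `[0, c/2]`, `[c/2, 3c/4]` and `[3c/4, c]` are `1/2`, `1`
and `2`. -/
def generator (c : ℝ) (hc : 0 < c) : ℝ ≃o ℝ :=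
  StrictMono.orderIsoOfRightInverse
    (fun s => min s (max (s / 2) (max (s - c / 4) (2 * s - c))))
    (fun s t hst => by grind)
    (fun s => max s (min (2 * s) (min (s + c / 4) ((s + c) / 2))))
    (fun s => by grind)

variable {c : ℝ} (hc : 0 < c)

theorem generator_apply (s : ℝ) :
    generator c hc s = min s (max (s / 2) (max (s - c / 4) (2 * s - c))) := rfl

theorem generator_of_notMem_Ioo {s : ℝ} (hs : s ∉ Set.Ioo 0 c) : generator c hc s = s := by
  rw [generator_apply]
  grind

theorem generator_lt {s : ℝ} (hs : s ∈ Set.Ioo 0 c) : generator c hc s < s := by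
  rw [generator_apply]
  grind

theorem affineNear_generator {t : ℝ} (ht : t ∉ ({0, c / 2, 3 * c / 4, c} : Set ℝ)) :
    AffineNear (generator c hc) t := by
  simp only [Set.mem_insert_iff, Set.mem_singleton_iff, not_or] at ht
  obtain ⟨h₀, h₁, h₂, h₃⟩ := ht
  have hcases : t < 0 ∨ t ∈ Set.Ioo 0 (c / 2) ∨ t ∈ Set.Ioo (c / 2) (3 * c / 4) ∨
      t ∈ Set.Ioo (3 * c / 4) c ∨ c < t := by grind
  rcases hcases with h | h | h | h | h
  · refine ⟨0, 0, ?_⟩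
    filter_upwards [Iio_mem_nhds h] with s hs
    rw [zpow_zero, generator_apply]
    grind
  · refine ⟨-1, 0, ?_⟩
    filter_upwards [Ioo_mem_nhds h.1 h.2] with s hs
    rw [zpow_neg_one, generator_apply]
    grind
  · refine ⟨0, -c / 4, ?_⟩
    filter_upwards [Ioo_mem_nhds h.1 h.2] with s hs
    rw [zpow_zero, generator_apply]
    grind
  · refine ⟨1, -c, ?_⟩
    filter_upwards [Ioo_mem_nhds h.1 h.2] with s hs
    rw [zpow_one, generator_apply]
    grind
  · refine ⟨0, 0, ?_⟩
    filter_upwards [Ioi_mem_nhds h] with s hs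
    rw [zpow_zero, generator_apply]
    grind

theorem div_two_mem_dyadic {s : ℝ} (hs : s ∈ dyadic) : s / 2 ∈ dyadic := by
  simpa [div_eq_inv_mul] using zpow_mul_mem_dyadic hs (-1)

theorem generator_mem_dyadic (hcd : c ∈ dyadic) {s : ℝ} (hs : s ∈ dyadic) :
    generator c hc s ∈ dyadic := by
  have hleft : s / 2 ∈ dyadic := div_two_mem_dyadic hs
  have hmiddle : s - c / 4 ∈ dyadic := by
    rw [show c / 4 = c / 2 / 2 by ring]
    exact dyadic.sub_mem hs (div_two_mem_dyadic (div_two_mem_dyadic hcd))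
  have hright : 2 * s - c ∈ dyadic := two_mul s ▸ dyadic.sub_mem (dyadic.add_mem hs hs) hcd
  rw [generator_apply]
  rcases min_choice s (max (s / 2) (max (s - c / 4) (2 * s - c))) with h | h <;> grind

theorem map_fract_mem_Ico {f : ℝ ≃o ℝ} (h₀ : f 0 = 0) (h₁ : f 1 = 1) (t : ℝ) :
    f (Int.fract t) ∈ Set.Ico 0 1 :=
  ⟨h₀.symm.trans_le (f.monotone (Int.fract_nonneg t)),
    (f.strictMono (Int.fract_lt_one t)).trans_eq h₁⟩

/-- The homeomorphism of `ℝ` commuting with `t ↦ t + 1` that agrees on `[0, 1]` with a given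
homeomorphism fixing `0` and `1`. -/
def periodize (f : ℝ ≃o ℝ) (h₀ : f 0 = 0) (h₁ : f 1 = 1) : ℝ ≃o ℝ :=
  StrictMono.orderIsoOfRightInverse (fun t => ⌊t⌋ + f (Int.fract t))
    (fun s t hst => by
      obtain hfloor | hfloor := (Int.floor_mono hst.le).eq_or_lt
      · have hfract : Int.fract s < Int.fract t := by
          rw [Int.fract, Int.fract, hfloor]
          exact sub_lt_sub_right hst _
        simpa only [hfloor, add_lt_add_iff_left] using f.strictMono hfract
      · have hfloor' : (⌊s⌋ + 1 : ℝ) ≤ ⌊t⌋ := mod_cast hfloor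
        calc
          ⌊s⌋ + f (Int.fract s) < ⌊s⌋ + 1 := by grw [(map_fract_mem_Ico h₀ h₁ s).2]
          _ ≤ ⌊t⌋ + f (Int.fract t) := by
            linarith [(map_fract_mem_Ico h₀ h₁ t).1])
    (fun t => ⌊t⌋ + f.symm (Int.fract t))
    (fun t => by
      have hIco := map_fract_mem_Ico (f.symm_apply_eq.2 h₀.symm) (f.symm_apply_eq.2 h₁.symm) t
      beta_reduce
      rw [Int.floor_intCast_add, Int.floor_eq_zero_iff.2 hIco, add_zero, Int.fract_intCast_add,
        Int.fract_eq_self.2 hIco, OrderIso.apply_symm_apply, Int.floor_add_fract])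

section

variable {f : ℝ ≃o ℝ} (h₀ : f 0 = 0) (h₁ : f 1 = 1)

theorem periodize_apply (t : ℝ) : periodize f h₀ h₁ t = ⌊t⌋ + f (Int.fract t) := rfl

theorem periodize_add_one (t : ℝ) : periodize f h₀ h₁ (t + 1) = periodize f h₀ h₁ t + 1 := by
  rw [periodize_apply, periodize_apply, Int.floor_add_one, Int.fract_add_one]
  push_cast
  ring

theorem periodize_mem_dyadic (hf : ∀ t ∈ dyadic, f t ∈ dyadic) {t : ℝ} (ht : t ∈ dyadic) :
    periodize f h₀ h₁ t ∈ dyadic :=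
  dyadic.add_mem (intCast_mem dyadic _) (hf _ (dyadic.sub_mem ht (intCast_mem dyadic _)))

theorem affineNear_periodize {t : ℝ} (ht : Int.fract t ≠ 0) (h : AffineNear f (Int.fract t)) :
    AffineNear (periodize f h₀ h₁) t := by
  obtain ⟨k, c, h⟩ := h
  refine ⟨k, c + ⌊t⌋ - 2 ^ k * ⌊t⌋, ?_⟩
  have hfloor : ∀ᶠ s in 𝓝 t, ⌊s⌋ = ⌊t⌋ := by
    have ht' : (⌊t⌋ : ℝ) < t := by
      rw [← sub_pos]
      exact (Int.fract_nonneg t).lt_of_ne' ht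
    filter_upwards [Ioo_mem_nhds ht' (Int.lt_floor_add_one t)] with s hs
    exact Int.floor_eq_iff.2 ⟨hs.1.le, hs.2⟩
  have hfract : Tendsto (fun s : ℝ => s - ⌊t⌋) (𝓝 t) (𝓝 (Int.fract t)) :=
    (continuous_sub_right _).tendsto t
  filter_upwards [hfloor, hfract.eventually h] with s hs hfs
  rw [periodize_apply, Int.fract, hs, hfs]
  ring

theorem coe_periodize (t : ℝ) :
    ((periodize f h₀ h₁ t : ℝ) : UnitAddCircle) = f (Int.fract t) := by
  rw [periodize_apply, add_comm, coe_add_intCast]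

theorem coe_fract (t : ℝ) : ((Int.fract t : ℝ) : UnitAddCircle) = t := by
  rw [← coe_add_intCast _ ⌊t⌋, Int.fract_add_floor]

theorem isThompson_circleHomeo_periodize {B : Set ℝ} (hB : B.Finite) (hB₀ : 0 ∈ B)
    (hBd : ∀ t ∈ B, t ∈ dyadic) (ha : ∀ t ∉ B, AffineNear f t)
    (hd : ∀ t ∈ dyadic, f t ∈ dyadic) :
    IsThompson (circleHomeo (periodize f h₀ h₁) (periodize_add_one h₀ h₁)) := by
  refine isThompson_circleHomeo _ (hB.image (↑)) ?_ (fun t ht => ?_) fun t =>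
    periodize_mem_dyadic h₀ h₁ hd
  · rintro _ ⟨t, ht, rfl⟩
    exact coe_mem_dyadicPoints.2 (hBd t ht)
  · rw [← coe_fract] at ht
    exact affineNear_periodize h₀ h₁ (fun h => ht ⟨0, hB₀, by rw [h]⟩)
      (ha _ fun h => ht ⟨_, h, rfl⟩)

end

theorem exists_thompsonT_support_Ioo_zero (hc : 0 < c) (hc₁ : c ≤ 1) (hcd : c ∈ dyadic) :
    ∃ g : thompsonT, (∀ t ∈ Set.Ioo 0 c, g • (t : UnitAddCircle) ≠ t) ∧
      ∀ w ∉ ((↑) '' Set.Ioo 0 c : Set UnitAddCircle), g • w = w := by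
  have h₀ : generator c hc 0 = 0 := generator_of_notMem_Ioo hc (by simp)
  have h₁ : generator c hc 1 = 1 := generator_of_notMem_Ioo hc (by simp [hc₁])
  have hB (t : ℝ) (ht : t ∈ ({0, c / 2, 3 * c / 4, c} : Set ℝ)) : t ∈ dyadic := by
    have hhalf := div_two_mem_dyadic hcd
    rcases ht with rfl | rfl | rfl | rfl
    · exact dyadic.zero_mem
    · exact hhalf
    · rw [show 3 * c / 4 = c / 2 + c / 2 / 2 by ring]
      exact dyadic.add_mem hhalf (div_two_mem_dyadic hhalf)
    · exact hcd
  let g : thompsonT := ⟨_, isThompson_circleHomeo_periodize h₀ h₁ (Set.toFinite _) (by simp) hB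
    (fun _ => affineNear_generator hc) fun _ => generator_mem_dyadic hc hcd⟩
  have hg (t : ℝ) : g • (t : UnitAddCircle) = generator c hc (Int.fract t) :=
    coe_periodize h₀ h₁ t
  refine ⟨g, fun t ht => ?_, fun w hw => ?_⟩
  · have htIco : t ∈ Set.Ico 0 (0 + 1 : ℝ) := ⟨ht.1.le, by linarith [ht.2]⟩
    have hgIco := map_fract_mem_Ico h₀ h₁ t
    rw [← zero_add (1 : ℝ), Int.fract_eq_self.2 (by simpa using htIco)] at hgIco
    rw [hg, Int.fract_eq_self.2 (by simpa using htIco), ne_eq,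
      AddCircle.coe_eq_coe_iff_of_mem_Ico hgIco htIco]
    exact (generator_lt hc ht).ne
  · obtain ⟨t, rfl⟩ := QuotientAddGroup.mk_surjective w
    have hfract : Int.fract t ∉ Set.Ioo 0 c := fun h => hw ⟨_, h, coe_fract t⟩
    exact (hg t).trans ((congrArg _ (generator_of_notMem_Ioo hc hfract)).trans (coe_fract t))

theorem exists_thompsonT_support_Ioo {a b : ℝ} (ha : a ∈ dyadic) (hb : b ∈ dyadic) (hab : a < b)
    (hba : b ≤ a + 1) :
    ∃ g : thompsonT, (∀ t ∈ Set.Ioo a b, g • (t : UnitAddCircle) ≠ t) ∧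
      ∀ w ∉ ((↑) '' Set.Ioo a b : Set UnitAddCircle), g • w = w := by
  obtain ⟨g, hmove, hfix⟩ := exists_thompsonT_support_Ioo_zero (sub_pos.2 hab) (by linarith)
    (dyadic.sub_mem hb ha)
  obtain ⟨r, hr⟩ := exists_rotation_mem_thompsonT ha
  have hrinv (t : ℝ) : r⁻¹ • (t : UnitAddCircle) = (t - a : ℝ) := by
    rw [inv_smul_eq_iff, hr, sub_add_cancel]
  refine ⟨r * g * r⁻¹, fun t ht => ?_, fun w hw => ?_⟩
  · rw [mul_smul, mul_smul, ne_eq, ← eq_inv_smul_iff, hrinv]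
    exact hmove _ ⟨sub_pos.2 ht.1, sub_lt_sub_right ht.2 a⟩
  · rw [mul_smul, mul_smul, ← eq_inv_smul_iff]
    refine hfix _ fun ⟨s, hs, hsw⟩ => hw ⟨s + a, ⟨by linarith [hs.1], by linarith [hs.2]⟩, ?_⟩
    rw [← hr, hsw, smul_inv_smul]

theorem exists_thompsonT_smul_ne {z : UnitAddCircle} {U : Set UnitAddCircle} (hU : U ∈ 𝓝 z) :
    ∃ g : thompsonT, g • z ≠ z ∧ ∀ w ∉ U, g • w = w := by
  obtain ⟨t, rfl⟩ := QuotientAddGroup.mk_surjective z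
  rw [QuotientAddGroup.nhds_eq, mem_map, mem_nhds_iff_exists_Ioo_subset] at hU
  obtain ⟨l, u, ht, hlu⟩ := hU
  obtain ⟨a, ha, hla, hat⟩ := dense_dyadic.exists_between (max_lt ht.1 (sub_lt_self t one_half_pos))
  obtain ⟨b, hb, htb, hbu⟩ :=
    dense_dyadic.exists_between (lt_min ht.2 (lt_add_of_pos_right t one_half_pos))
  obtain ⟨g, hmove, hfix⟩ := exists_thompsonT_support_Ioo ha hb (hat.trans htb) (by grind)
  refine ⟨g, hmove t ⟨hat, htb⟩, fun w hw => hfix w ?_⟩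
  rintro ⟨s, hs, rfl⟩
  exact hw (hlu ⟨by grind, by grind⟩)

theorem infinite_orbit_stabilizer_thompsonT {x z : UnitAddCircle} (hzx : z ≠ x) :
    (MulAction.orbit (MulAction.stabilizer thompsonT x) z).Infinite :=
  infinite_orbit_stabilizer (fun _ => exists_thompsonT_smul_ne) hzx

end SmallSupport

end

end ThompsonRep

theorem mainTheorem6_general (x y : UnitAddCircle) :
    (∀ (K : Type*) [NormedAddCommGroup K] [InnerProductSpace ℂ K] [FiniteDimensional ℂ K]
      (σ : MulAction.stabilizer thompsonT x →* (K ≃ₗᵢ[ℂ] K)),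
      IsIrreducibleRep σ → IsIrreducibleRep (ind σ)) ∧
    (∀ (K : Type*) [NormedAddCommGroup K] [InnerProductSpace ℂ K] [FiniteDimensional ℂ K]
      [Nontrivial K] (K' : Type*) [NormedAddCommGroup K'] [InnerProductSpace ℂ K']
      (σ : MulAction.stabilizer thompsonT x →* (K ≃ₗᵢ[ℂ] K))
      (ρ : MulAction.stabilizer thompsonT y →* (K' ≃ₗᵢ[ℂ] K')),
      (UnitarilyEquivalent (ind σ) (ind ρ) ↔
        ∃ (g : thompsonT) (h : g • x = y),
          UnitarilyEquivalent ρ (conjRep g⁻¹ (stabilizer_eq_conj h) σ))) ∧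
    (y ∉ MulAction.orbit thompsonT x →
      ¬ RepEquivalent (MulAction.stabilizer thompsonT x) (MulAction.stabilizer thompsonT y)) ∧
    (x ∉ rationalPoints → y ∉ rationalPoints →
      WeaklyConjugate (MulAction.stabilizer thompsonT x) (MulAction.stabilizer thompsonT y)) := by
  have hfix (z : UnitAddCircle) (hz : z ∉ rationalPoints)
      (g : thompsonT) (hg : g ∈ MulAction.stabilizer thompsonT z) : ∀ᶠ w in nhds z, g • w = w :=
    eventually_smul_eq_of_notMem_rationalPoints hz hg
  refine ⟨fun K _ _ _ σ hσ => ?irreducible, fun K _ _ _ _ K' _ _ _ _ => ?equivalent,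
    fun hy => ?quasiregular, fun hx hy => ?weaklyConjugate⟩
  case irreducible =>
    exact isIrreducibleRep_ind_stabilizer (fun _ => infinite_orbit_stabilizer_thompsonT) hσ
  case equivalent =>
    exact unitarilyEquivalent_ind_stabilizer_iff (fun _ => infinite_orbit_stabilizer_thompsonT)
      (fun _ => infinite_orbit_stabilizer_thompsonT)
  case quasiregular =>
    exact not_repEquivalent_stabilizer (fun _ => infinite_orbit_stabilizer_thompsonT) hy
  case weaklyConjugate =>
    exact weaklyConjugate_stabilizer (hfix x hx) (hfix y hy)

theorem mainTheorem6 (x y : UnitAddCircle) :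
    (∀ (K : Type*) [NormedAddCommGroup K] [InnerProductSpace ℂ K] [FiniteDimensional ℂ K]
      (σ : MulAction.stabilizer thompsonT x →* (K ≃ₗᵢ[ℂ] K)),
      IsIrreducibleRep σ → IsIrreducibleRep (ind σ)) ∧
    (∀ (K : Type*) [NormedAddCommGroup K] [InnerProductSpace ℂ K] [FiniteDimensional ℂ K]
      (K' : Type*) [NormedAddCommGroup K'] [InnerProductSpace ℂ K'] [FiniteDimensional ℂ K']
      (σ : MulAction.stabilizer thompsonT x →* (K ≃ₗᵢ[ℂ] K))
      (ρ : MulAction.stabilizer thompsonT y →* (K' ≃ₗᵢ[ℂ] K')),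
      IsIrreducibleRep σ → IsIrreducibleRep ρ →
      (UnitarilyEquivalent (ind σ) (ind ρ) ↔
        ∃ (g : thompsonT) (h : g • x = y),
          UnitarilyEquivalent ρ (conjRep g⁻¹ (stabilizer_eq_conj h) σ))) ∧
    (y ∉ MulAction.orbit thompsonT x →
      ¬ RepEquivalent (MulAction.stabilizer thompsonT x) (MulAction.stabilizer thompsonT y)) ∧
    (x ∉ rationalPoints → y ∉ rationalPoints →
      WeaklyConjugate (MulAction.stabilizer thompsonT x) (MulAction.stabilizer thompsonT y)) := by
  obtain ⟨hirr, hequiv, hrest⟩ := mainTheorem6_general x y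
  exact ⟨hirr, fun K _ _ _ K' _ _ _ σ ρ hσ _ => haveI := hσ.1; hequiv K K' σ ρ, hrest⟩
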